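/- Let $p,\tilde p:[0,1]\to\mathbb R$ be piecewise continuous (finitely many discontinuities, finite one-sided limits everywhere), positive and bounded away from $0$, and let $\alpha\in(0,\pi]$, $\beta\in[0,\pi)$. Denote by $\lambda_0<\lambda_1<\cdots$ the eigenvalues, all real and simple, of the boundary value problem $$-u''=\lambda\,p(x)\,u\ \text{ on }(0,1),\qquad u(0)\cos\alpha+u'(0)\sin\alpha=0,\qquad u(1)\cos\beta+u'(1)\sin\beta=0,$$ where a solution $u$ is continuously differentiable on $[0,1]$ and satisfies the equation at every point of $(0,1)$ at which the density is continuous; denote by $\tilde\lambda_0<\tilde\lambda_1<\cdots$ the eigenvalues of the same problem with $\tilde p$ in place of $p$. Let $\tilde\varphi_n$ be the solution of $-u''=\tilde\lambda_n\tilde p\,u$ with $u(0)=\sin\alpha$, $u'(0)=-\cos\alpha$ (an eigenfunction for $\tilde\lambda_n$). Put $\check p=\tilde p/p$ and $(y,z)=\int_0^1 y(x)\overline{z(x)}\,dx$. Fix $n>0$ with $\lambda_n\neq0$, and suppose that $$\lambda_n=\tilde\lambda_n\,\frac{(\check p\,\tilde\varphi_n,\tilde\varphi_n)}{(\tilde\varphi_n,\tilde\varphi_n)}$$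 and, in addition, that $$\lambda_n=\tilde\lambda_n\sup_{x\in[0,1]}\check p(x)\qquad\text{or}\qquad\lambda_n=\tilde\lambda_n\inf_{x\in[0,1]}\check p(x).$$ Then $p(x)=\dfrac{\tilde\lambda_n}{\lambda_n}\,\tilde p(x)$ for all but finitely many $x\in[0,1]$, and in fact at every $x\in[0,1]$ at which $p$ and $\tilde p$ are both continuous from the right (with $x<1$) or both continuous from the left (with $x>0$). In particular, the identity holds at every point of $[0,1]$ if $p$ and $\tilde p$ are continuous on $[0,1]$, or if both are right-continuous on $[0,1)$ and left-continuous at $1$. -/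

import Mathlib

open Set Filter Topology

/-- Piecewise continuity on `[0, 1]`: finitely many interior discontinuities, and finite one-sided
limits everywhere. The values at the jump points and at the end points are not restricted. -/
structure IsPiecewiseContinuous (p : ℝ → ℝ) : Prop where
  finite_discontinuities : {x ∈ Ioo (0 : ℝ) 1 | ¬ ContinuousAt p x}.Finite
  right_limit : ∀ x ∈ Ico (0 : ℝ) 1, ∃ l : ℝ, Tendsto p (𝓝[>] x) (𝓝 l)
  left_limit : ∀ x ∈ Ioc (0 : ℝ) 1, ∃ l : ℝ, Tendsto p (𝓝[<] x) (𝓝 l)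

/-- Density functions of a string: piecewise continuous on `[0, 1]`, positive and bounded away
from `0`. -/
structure IsStringDensity (p : ℝ → ℝ) : Prop where
  piecewiseContinuous : IsPiecewiseContinuous p
  bounded_away : ∃ c : ℝ, 0 < c ∧ ∀ x ∈ Icc (0 : ℝ) 1, c ≤ p x

/-- The derivative on the interval `[0, 1]`, one-sided at the end points. -/
noncomputable def stringDeriv (u : ℝ → ℂ) (x : ℝ) : ℂ :=
  derivWithin u (Icc 0 1) x

/-- Solutions of `-u'' = lam p u` on `(0, 1)` for a piecewise continuous `p`: `u` is continuously
differentiable on `[0, 1]`, and `u'' = -lam p u` at every interior point of continuity of `p`. -/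
structure IsStringSolution (p : ℝ → ℝ) (lam : ℂ) (u : ℝ → ℂ) : Prop where
  contDiffOn : ContDiffOn ℝ 1 u (Icc 0 1)
  equation : ∀ x ∈ Ioo (0 : ℝ) 1, ContinuousAt p x →
    HasDerivAt (stringDeriv u) (-(lam * (p x : ℂ) * u x)) x

/-- Eigenfunctions of the boundary value problem `S(p, α, β)`. -/
structure IsStringEigenfunction (p : ℝ → ℝ) (α β : ℝ) (lam : ℂ) (u : ℝ → ℂ) : Prop where
  solution : IsStringSolution p lam u
  nontrivial : ∃ x ∈ Icc (0 : ℝ) 1, u x ≠ 0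
  left_boundary : u 0 * (Real.cos α : ℂ) + stringDeriv u 0 * (Real.sin α : ℂ) = 0
  right_boundary : u 1 * (Real.cos β : ℂ) + stringDeriv u 1 * (Real.sin β : ℂ) = 0

/-- Eigenvalues of `S(p, α, β)`. -/
def IsStringEigenvalue (p : ℝ → ℝ) (α β : ℝ) (lam : ℂ) : Prop :=
  ∃ u : ℝ → ℂ, IsStringEigenfunction p α β lam u

/-- `lam` is the eigenvalue `λₙ(p, α, β)` in the increasing enumeration `λ₀ < λ₁ < …`: it is an
eigenvalue and exactly `n` eigenvalues lie below it. -/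
def IsNthStringEigenvalue (p : ℝ → ℝ) (α β : ℝ) (n : ℕ) (lam : ℝ) : Prop :=
  IsStringEigenvalue p α β (lam : ℂ) ∧
    {μ : ℝ | IsStringEigenvalue p α β (μ : ℂ) ∧ μ < lam}.encard = (n : ℕ∞)

/-- `u` is the solution `φ(·, lam, α, p)` with `φ(0) = sin α` and `φ'(0) = -cos α`. -/
structure IsStringPhi (p : ℝ → ℝ) (α : ℝ) (lam : ℂ) (u : ℝ → ℂ) : Prop where
  solution : IsStringSolution p lam u
  initial_value : u 0 = (Real.sin α : ℂ)
  initial_deriv : stringDeriv u 0 = -(Real.cos α : ℂ)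

/-- The inner product `(y, z) = ∫₀¹ y z̄ dx`. -/
noncomputable def stringInner (y z : ℝ → ℂ) : ℂ :=
  ∫ x in (0 : ℝ)..1, y x * (starRingEnd ℂ) (z x)

/-- Both functions are continuous at `x` from a common side within `[0, 1]`. -/
def ContinuousFromCommonSide (p q : ℝ → ℝ) (x : ℝ) : Prop :=
  (x < 1 ∧ ContinuousWithinAt p (Icc x 1) x ∧ ContinuousWithinAt q (Icc x 1) x) ∨
    (0 < x ∧ ContinuousWithinAt p (Icc 0 x) x ∧ ContinuousWithinAt q (Icc 0 x) x)

/-! Let `S` be the extreme value of `pt / p` with `lam = lamt * S`. Since `lam ≠ 0`, also `lamt ≠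
0`, and cancelling it in the quotient identity shows that the mean of `pt / p` with weight `‖phit‖ ^
2` equals `S`. Hence `(pt / p - S) * ‖phit‖ ^ 2` has constant sign and zero integral, so it vanishes
almost everywhere. By `cauchyData_ne_zero`, `phit` cannot vanish on an interval, so `pt / p` takes
the value `S` inside every subinterval (`exists_eq_of_weightedMean_extreme`). One-sided continuity
carries the identity to individual points (`eq_of_continuousFromCommonSide`). -/

open MeasureTheory

/-! ### Piecewise continuous functions: boundedness and measurability -/

namespace IsPiecewiseContinuous

variable {p : ℝ → ℝ}

theorem bounded (hp : IsPiecewiseContinuous p) :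
    ∃ M : ℝ, 0 ≤ M ∧ ∀ x ∈ Icc (0 : ℝ) 1, |p x| ≤ M := by
  have key : ∃ M : ℝ, ∀ x ∈ Icc (0 : ℝ) 1, |p x| ≤ M := by
    refine (isCompact_Icc (a := (0 : ℝ)) (b := 1)).induction_on
      (p := fun s => ∃ M : ℝ, ∀ x ∈ s, |p x| ≤ M) ⟨0, by simp⟩ ?_ ?_ ?_
    · rintro s t hst ⟨M, hM⟩
      exact ⟨M, fun x hx => hM x (hst hx)⟩
    · rintro s t ⟨M, hM⟩ ⟨N, hN⟩
      refine ⟨max M N, fun x hx => ?_⟩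
      rcases hx with hx | hx
      · exact (hM x hx).trans (le_max_left _ _)
      · exact (hN x hx).trans (le_max_right _ _)
    · intro x hx
      have hR : ∃ A : ℝ, ∀ᶠ y in 𝓝[>] x, y ∈ Icc (0 : ℝ) 1 → |p y| ≤ A := by
        rcases hx.2.lt_or_eq with h | rfl
        · obtain ⟨l, hl⟩ := hp.right_limit x ⟨hx.1, h⟩
          refine ⟨|l| + 1, ?_⟩
          filter_upwards [hl.abs.eventually_le_const (lt_add_one |l|)] with y hy _ using hy
        · refine ⟨0, ?_⟩
          filter_upwards [self_mem_nhdsWithin] with y hy h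
          exact absurd h.2 (not_le.2 hy)
      have hL : ∃ A : ℝ, ∀ᶠ y in 𝓝[<] x, y ∈ Icc (0 : ℝ) 1 → |p y| ≤ A := by
        rcases hx.1.lt_or_eq with h | rfl
        · obtain ⟨l, hl⟩ := hp.left_limit x ⟨h, hx.2⟩
          refine ⟨|l| + 1, ?_⟩
          filter_upwards [hl.abs.eventually_le_const (lt_add_one |l|)] with y hy _ using hy
        · refine ⟨0, ?_⟩
          filter_upwards [self_mem_nhdsWithin] with y hy h
          exact absurd h.1 (not_le.2 hy)
      obtain ⟨A, hA⟩ := hR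
      obtain ⟨B, hB⟩ := hL
      rw [eventually_nhdsWithin_iff] at hA hB
      -- The one-sided limits say nothing about the value at `x` itself, hence the extra term `|p
      -- x|`.
      refine ⟨{y | y ∈ Icc (0 : ℝ) 1 ∧ |p y| ≤ max (max A B) |p x|}, ?_, max (max A B) |p x|,
        fun y hy => hy.2⟩
      filter_upwards [mem_nhdsWithin_of_mem_nhds hA, mem_nhdsWithin_of_mem_nhds hB,
        self_mem_nhdsWithin] with y h1 h2 h3
      refine ⟨h3, ?_⟩
      rcases lt_trichotomy y x with h | rfl | h
      · exact (h2 h h3).trans ((le_max_right _ _).trans (le_max_left _ _))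
      · exact le_max_right _ _
      · exact (h1 h h3).trans ((le_max_left _ _).trans (le_max_left _ _))
  obtain ⟨M, hM⟩ := key
  exact ⟨M, (abs_nonneg _).trans (hM 0 (by simp)), hM⟩

theorem eventually_continuousAt_right (hp : IsPiecewiseContinuous p) {x : ℝ}
    (hx : x ∈ Ico (0 : ℝ) 1) : ∀ᶠ y in 𝓝[>] x, y ∈ Ioo (0 : ℝ) 1 ∧ ContinuousAt p y := by
  have h1 : ∀ᶠ y in 𝓝[>] x, y ∈ Ioo x 1 := Ioo_mem_nhdsGT hx.2
  have h2 : ∀ᶠ y in 𝓝[>] x, y ∉ {x ∈ Ioo (0 : ℝ) 1 | ¬ ContinuousAt p x} \ {x} :=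
    mem_nhdsWithin_of_mem_nhds
      ((hp.finite_discontinuities.subset sdiff_subset).isClosed.isOpen_compl.mem_nhds (by simp))
  filter_upwards [h1, h2] with y hy h
  have hy' : y ∈ Ioo (0 : ℝ) 1 := ⟨hx.1.trans_lt hy.1, hy.2⟩
  refine ⟨hy', by_contra fun hc => h ⟨⟨hy', hc⟩, hy.1.ne'⟩⟩

theorem aestronglyMeasurable (hp : IsPiecewiseContinuous p) :
    AEStronglyMeasurable p (volume.restrict (Ioc (0 : ℝ) 1)) := by
  set D := {x ∈ Ioo (0 : ℝ) 1 | ¬ ContinuousAt p x}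
  have hc : ContinuousOn p (Ioo (0 : ℝ) 1 \ D) := fun x hx =>
    (by_contra fun h => hx.2 ⟨hx.1, h⟩ : ContinuousAt p x).continuousWithinAt
  have hm := hc.aestronglyMeasurable (μ := volume)
    (measurableSet_Ioo.diff hp.finite_discontinuities.measurableSet)
  have he : (Ioo (0 : ℝ) 1 \ D : Set ℝ) =ᵐ[volume] Ioc (0 : ℝ) 1 :=
    (sdiff_null_ae_eq_self (hp.finite_discontinuities.measure_zero volume)).trans Ioo_ae_eq_Ioc
  rwa [Measure.restrict_congr_set he] at hm

end IsPiecewiseContinuous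

/-! ### Solutions do not vanish on intervals -/

namespace IsStringSolution

variable {p : ℝ → ℝ} {lam : ℂ} {u : ℝ → ℂ}

theorem continuousOn_stringDeriv (hu : IsStringSolution p lam u) :
    ContinuousOn (stringDeriv u) (Icc 0 1) :=
  hu.contDiffOn.continuousOn_derivWithin (uniqueDiffOn_Icc one_pos) le_rfl

theorem hasDerivWithinAt (hu : IsStringSolution p lam u) {x : ℝ} (hx : x ∈ Icc (0 : ℝ) 1) :
    HasDerivWithinAt u (stringDeriv u x) (Icc 0 1) x :=
  (hu.contDiffOn.differentiableOn one_ne_zero x hx).hasDerivWithinAt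

/-- At every point, the derivative of a solution has a right derivative, given by the right limit
of the density. -/
theorem hasDerivWithinAt_stringDeriv_Ici (hp : IsPiecewiseContinuous p)
    (hu : IsStringSolution p lam u) {x l : ℝ} (hx : x ∈ Ico (0 : ℝ) 1)
    (hl : Tendsto p (𝓝[>] x) (𝓝 l)) :
    HasDerivWithinAt (stringDeriv u) (-(lam * (l : ℂ) * u x)) (Ici x) x := by
  have hev := hp.eventually_continuousAt_right hx
  have hxI : x ∈ Icc (0 : ℝ) 1 := ⟨hx.1, hx.2.le⟩
  have hle : 𝓝[>] x ≤ 𝓝[Icc 0 1] x :=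
    nhdsWithin_le_iff.2 (Icc_mem_nhdsGT_of_mem hx)
  refine hasDerivWithinAt_Ici_of_tendsto_deriv
    (s := {y | y ∈ Ioo (0 : ℝ) 1 ∧ ContinuousAt p y}) ?_ ?_ hev ?_
  · exact fun y hy => (hu.equation y hy.1 hy.2).differentiableAt.differentiableWithinAt
  · exact (hu.continuousOn_stringDeriv x hxI).mono fun y hy => Ioo_subset_Icc_self hy.1
  · have hux : Tendsto u (𝓝[>] x) (𝓝 (u x)) := (hu.contDiffOn.continuousOn x hxI).mono_left hle
    have ht : Tendsto (fun y => -(lam * (p y : ℂ) * u y)) (𝓝[>] x)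
        (𝓝 (-(lam * (l : ℂ) * u x))) :=
      ((tendsto_const_nhds.mul ((Complex.continuous_ofReal.tendsto l).comp hl)).mul hux).neg
    refine ht.congr' ?_
    filter_upwards [hev] with y hy
    exact (hu.equation y hy.1 hy.2).deriv.symm

/-- A solution with nonzero Cauchy data at `0` has nonzero Cauchy data everywhere. -/
theorem cauchyData_ne_zero (hp : IsPiecewiseContinuous p) (hu : IsStringSolution p lam u)
    (h0 : u 0 ≠ 0 ∨ stringDeriv u 0 ≠ 0) {x : ℝ} (hx : x ∈ Icc (0 : ℝ) 1) :
    u x ≠ 0 ∨ stringDeriv u x ≠ 0 := by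
  obtain ⟨M, hM0, hM⟩ := hp.bounded
  set v := stringDeriv u
  -- Gronwall argument: `E = ‖u‖ ^ 2 + ‖v‖ ^ 2` satisfies `E' ≥ -2 (1 + ‖lam‖ M) ‖u‖ ‖v‖ ≥ -K E`, so
  -- `exp (K y) * E` is nondecreasing and stays positive.
  set K : ℝ := 1 + ‖lam‖ * M
  have hK : 0 ≤ ‖lam‖ * M := by positivity
  -- At a jump of `p`, right limits still give a right derivative of `v`, which is all the
  -- comparison lemma needs.
  choose! l hl using hp.right_limit
  have hlM : ∀ y ∈ Ico (0 : ℝ) 1, |l y| ≤ M := fun y hy => by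
    refine le_of_tendsto (hl y hy).abs ?_
    filter_upwards [hp.eventually_continuousAt_right hy] with z hz
    exact hM z (Ioo_subset_Icc_self hz.1)
  let w : ℝ → ℂ := fun y => -(lam * (l y : ℂ) * u y)
  have hd : ∀ y ∈ Ico (0 : ℝ) 1, HasDerivWithinAt
      (fun y => -(Real.exp (K * y) * (‖u y‖ ^ 2 + ‖v y‖ ^ 2)))
      (-(Real.exp (K * y) * (K * 1) * (‖u y‖ ^ 2 + ‖v y‖ ^ 2) +
        Real.exp (K * y) * (2 * inner ℝ (u y) (v y) + 2 * inner ℝ (v y) (w y)))) (Ici y) y := by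
    intro y hy
    have hud : HasDerivWithinAt u (v y) (Ici y) y :=
      (hu.hasDerivWithinAt ⟨hy.1, hy.2.le⟩).mono_of_mem_nhdsWithin (Icc_mem_nhdsGE_of_mem hy)
    have hvd : HasDerivWithinAt v (w y) (Ici y) y :=
      hu.hasDerivWithinAt_stringDeriv_Ici hp hy (hl y hy)
    have he : HasDerivWithinAt (fun y => Real.exp (K * y)) (Real.exp (K * y) * (K * 1)) (Ici y) y :=
      (((hasDerivAt_id y).const_mul K).exp).hasDerivWithinAt
    exact (he.mul (hud.norm_sq.add hvd.norm_sq)).neg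
  have hcont : ContinuousOn (fun y => -(Real.exp (K * y) * (‖u y‖ ^ 2 + ‖v y‖ ^ 2)))
      (Icc 0 1) := by
    have h1 : ContinuousOn u (Icc 0 1) := hu.contDiffOn.continuousOn
    have h2 : ContinuousOn v (Icc 0 1) := hu.continuousOn_stringDeriv
    fun_prop
  have hbound : ∀ y ∈ Ico (0 : ℝ) 1,
      -(Real.exp (K * y) * (K * 1) * (‖u y‖ ^ 2 + ‖v y‖ ^ 2) +
        Real.exp (K * y) * (2 * inner ℝ (u y) (v y) + 2 * inner ℝ (v y) (w y))) ≤ 0 := by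
    intro y hy
    have h1 := (abs_le.1 (abs_real_inner_le_norm (u y) (v y))).1
    have h2 := (abs_le.1 (abs_real_inner_le_norm (v y) (w y))).1
    have h3 : ‖w y‖ ≤ ‖lam‖ * M * ‖u y‖ := by
      simp only [w, norm_neg, norm_mul, Complex.norm_real, Real.norm_eq_abs]
      gcongr
      exact hlM y hy
    have h4 : ‖v y‖ * ‖w y‖ ≤ ‖v y‖ * (‖lam‖ * M * ‖u y‖) := by gcongr
    have h5 : 2 * (‖u y‖ * ‖v y‖) ≤ ‖u y‖ ^ 2 + ‖v y‖ ^ 2 := by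
      nlinarith [sq_nonneg (‖u y‖ - ‖v y‖)]
    have h6 := mul_le_mul_of_nonneg_left h5 hK
    have h7 : 0 ≤ K * (‖u y‖ ^ 2 + ‖v y‖ ^ 2) +
        (2 * inner ℝ (u y) (v y) + 2 * inner ℝ (v y) (w y)) := by
      simp only [K]
      linarith
    have h8 := mul_nonneg (Real.exp_pos (K * y)).le h7
    linarith
  have hle := image_le_of_deriv_right_le_deriv_boundary hcont hd
    (B := fun _ => -(Real.exp (K * 0) * (‖u 0‖ ^ 2 + ‖v 0‖ ^ 2))) (B' := fun _ => 0) le_rfl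
    continuousOn_const (fun y _ => hasDerivWithinAt_const _ _ _) hbound hx
  by_contra! hcon
  have hpos : 0 < ‖u 0‖ ^ 2 + ‖v 0‖ ^ 2 := by
    rcases h0 with h | h
    · have := norm_pos_iff.2 h
      positivity
    · have := norm_pos_iff.2 h
      positivity
  rw [hcon.1, hcon.2] at hle
  simp at hle
  linarith

/-- Vanishing on an open interval would make the derivative vanish there too, contradicting
`cauchyData_ne_zero`. -/
theorem exists_ne_zero_mem_Ioo (hp : IsPiecewiseContinuous p) (hu : IsStringSolution p lam u)
    (h0 : u 0 ≠ 0 ∨ stringDeriv u 0 ≠ 0) {a b : ℝ} (ha : 0 ≤ a) (hab : a < b) (hb : b ≤ 1) :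
    ∃ y ∈ Ioo a b, u y ≠ 0 := by
  by_contra! h
  obtain ⟨y, hy⟩ := exists_between hab
  have hyI : y ∈ Ioo (0 : ℝ) 1 := ⟨ha.trans_lt hy.1, hy.2.trans_le hb⟩
  rcases hu.cauchyData_ne_zero hp h0 (Ioo_subset_Icc_self hyI) with h1 | h1
  · exact h1 (h y hy)
  · apply h1
    have hev : u =ᶠ[𝓝 y] fun _ => 0 := by
      filter_upwards [Ioo_mem_nhds hy.1 hy.2] with z hz using h z hz
    have hd := ((hu.hasDerivWithinAt (Ioo_subset_Icc_self hyI)).hasDerivAt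
      (Icc_mem_nhds hyI.1 hyI.2))
    exact hd.unique ((hasDerivAt_const y (0 : ℂ)).congr_of_eventuallyEq hev)

end IsStringSolution

theorem IsStringPhi.cauchyData_zero_ne_zero {p : ℝ → ℝ} {α : ℝ} {lam : ℂ} {u : ℝ → ℂ}
    (hu : IsStringPhi p α lam u) : u 0 ≠ 0 ∨ stringDeriv u 0 ≠ 0 := by
  rw [hu.initial_value, hu.initial_deriv, neg_ne_zero, Complex.ofReal_ne_zero,
    Complex.ofReal_ne_zero]
  by_contra! h
  have := Real.sin_sq_add_cos_sq α
  simp [h.1, h.2] at this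

/-! ### The density ratio and its weighted mean -/

theorem IsStringDensity.div_mem_Icc {p q : ℝ → ℝ} (hp : IsStringDensity p)
    (hq : IsStringDensity q) : ∃ C : ℝ, ∀ x ∈ Icc (0 : ℝ) 1, q x / p x ∈ Icc 0 C := by
  obtain ⟨c, hc, hcp⟩ := hp.bounded_away
  obtain ⟨d, hd, hdq⟩ := hq.bounded_away
  obtain ⟨M, hM0, hM⟩ := hq.piecewiseContinuous.bounded
  refine ⟨M / c, fun x hx => ⟨?_, ?_⟩⟩
  · exact div_nonneg (hd.le.trans (hdq x hx)) (hc.le.trans (hcp x hx))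
  · exact div_le_div₀ hM0 ((le_abs_self _).trans (hM x hx)) hc (hcp x hx)

theorem stringInner_ofReal_mul_self (f : ℝ → ℝ) (u : ℝ → ℂ) :
    stringInner (fun x => (f x : ℂ) * u x) u =
      ((∫ x in (0 : ℝ)..1, f x * ‖u x‖ ^ 2 : ℝ) : ℂ) := by
  rw [stringInner, ← intervalIntegral.integral_ofReal]
  congr 1
  ext x
  rw [mul_assoc, Complex.mul_conj, Complex.normSq_eq_norm_sq]
  push_cast
  rfl

theorem stringInner_self (u : ℝ → ℂ) :
    stringInner u u = ((∫ x in (0 : ℝ)..1, ‖u x‖ ^ 2 : ℝ) : ℂ) := by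
  simpa using stringInner_ofReal_mul_self (fun _ => 1) u

/-- If a weighted mean of `f` is an extreme value `S` of `f` on `[0, 1]`, then `f` takes the value
`S` in every interval on which the weight does not vanish identically. -/
theorem exists_eq_of_weightedMean_extreme {f : ℝ → ℝ} {u : ℝ → ℂ} {S : ℝ}
    (hu : ContinuousOn u (Icc 0 1))
    (hf : IntervalIntegrable (fun x => f x * ‖u x‖ ^ 2) volume 0 1)
    (hS : (∀ x ∈ Icc (0 : ℝ) 1, f x ≤ S) ∨ ∀ x ∈ Icc (0 : ℝ) 1, S ≤ f x)
    (hmean : ∫ x in (0 : ℝ)..1, f x * ‖u x‖ ^ 2 = S * ∫ x in (0 : ℝ)..1, ‖u x‖ ^ 2)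
    {a b : ℝ} (ha : 0 ≤ a) (hb : b ≤ 1) (hne : ∃ y ∈ Ioo a b, u y ≠ 0) :
    ∃ y ∈ Ioo a b, f y = S := by
  have hN : IntervalIntegrable (fun x => S * ‖u x‖ ^ 2) volume 0 1 := by
    refine ContinuousOn.intervalIntegrable ?_
    rw [uIcc_of_le zero_le_one]
    fun_prop
  have hg := hf.sub hN
  have hzero : ∫ x in (0 : ℝ)..1, (f x * ‖u x‖ ^ 2 - S * ‖u x‖ ^ 2) = 0 := by
    rw [intervalIntegral.integral_sub hf hN, intervalIntegral.integral_const_mul, hmean, sub_self]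
  have hae : (fun x => f x * ‖u x‖ ^ 2 - S * ‖u x‖ ^ 2) =ᵐ[volume.restrict (Ioc 0 1)] 0 := by
    rcases hS with hS | hS
    · have h0 : 0 ≤ᵐ[volume.restrict (Ioc (0 : ℝ) 1)]
          fun x => -(f x * ‖u x‖ ^ 2 - S * ‖u x‖ ^ 2) := by
        filter_upwards [ae_restrict_mem measurableSet_Ioc] with x hx
        have := mul_le_mul_of_nonneg_right (hS x (Ioc_subset_Icc_self hx)) (sq_nonneg ‖u x‖)
        simpa using this
      have hz : ∫ x in (0 : ℝ)..1, -(f x * ‖u x‖ ^ 2 - S * ‖u x‖ ^ 2) = 0 := by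
        rw [intervalIntegral.integral_neg, hzero, neg_zero]
      have := (intervalIntegral.integral_eq_zero_iff_of_le_of_nonneg_ae zero_le_one h0
        hg.neg).1 hz
      filter_upwards [this] with x hx
      simpa using neg_eq_zero.1 hx
    · have h0 : 0 ≤ᵐ[volume.restrict (Ioc (0 : ℝ) 1)]
          fun x => f x * ‖u x‖ ^ 2 - S * ‖u x‖ ^ 2 := by
        filter_upwards [ae_restrict_mem measurableSet_Ioc] with x hx
        have := mul_le_mul_of_nonneg_right (hS x (Ioc_subset_Icc_self hx)) (sq_nonneg ‖u x‖)
        simpa using this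
      exact (intervalIntegral.integral_eq_zero_iff_of_le_of_nonneg_ae zero_le_one h0 hg).1 hzero
  by_contra! hcon
  obtain ⟨y, hy, huy⟩ := hne
  have hyI : y ∈ Ioo (0 : ℝ) 1 := ⟨ha.trans_lt hy.1, hy.2.trans_le hb⟩
  have hev : ∀ᶠ z in 𝓝 y, z ∈ Ioo a b ∧ u z ≠ 0 :=
    Filter.Eventually.and (Ioo_mem_nhds hy.1 hy.2)
      ((hu.continuousAt (Icc_mem_nhds hyI.1 hyI.2)).eventually_ne huy)
  rw [Filter.EventuallyEq, ae_restrict_iff' measurableSet_Ioc] at hae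
  -- If `f ≠ S` on all of `Ioo a b`, this neighbourhood of `y` would lie in the null set where the
  -- integrand is nonzero.
  have hpos : 0 < volume {z | z ∈ Ioo a b ∧ u z ≠ 0} := Measure.measure_pos_of_mem_nhds volume hev
  refine hpos.ne' (measure_mono_null ?_ hae)
  rintro z ⟨hz, huz⟩ h
  have h1 := h ⟨ha.trans_lt hz.1, (hz.2.trans_le hb).le⟩
  simp only [Pi.zero_apply, ← sub_mul] at h1
  rcases mul_eq_zero.1 h1 with h2 | h2
  · exact hcon z hz (sub_eq_zero.1 h2)
  · exact huz (norm_eq_zero.1 (pow_eq_zero_iff two_ne_zero |>.1 h2))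

/-- The points of agreement accumulate at `x` from either side available in `[0, 1]`, so the two
one-sided limits coincide. -/
theorem eq_of_continuousFromCommonSide {p q : ℝ → ℝ}
    (h : ∀ a b : ℝ, 0 ≤ a → a < b → b ≤ 1 → ∃ y ∈ Ioo a b, p y = q y) {x : ℝ}
    (hx : x ∈ Icc (0 : ℝ) 1) (hc : ContinuousFromCommonSide p q x) : p x = q x := by
  rcases hc with ⟨hx1, hpc, hqc⟩ | ⟨hx0, hpc, hqc⟩
  · have hle : 𝓝[>] x ≤ 𝓝[Icc x 1] x := nhdsWithin_le_iff.2 (Icc_mem_nhdsGT hx1)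
    refine tendsto_nhds_unique_of_frequently_eq (hpc.mono_left hle) (hqc.mono_left hle) ?_
    rw [(nhdsGT_basis x).frequently_iff]
    intro b hb
    obtain ⟨y, hy, he⟩ := h x (min b 1) hx.1 (lt_min hb hx1) (min_le_right _ _)
    exact ⟨y, ⟨hy.1, hy.2.trans_le (min_le_left _ _)⟩, he⟩
  · have hle : 𝓝[<] x ≤ 𝓝[Icc 0 x] x := nhdsWithin_le_iff.2 (Icc_mem_nhdsLT hx0)
    refine tendsto_nhds_unique_of_frequently_eq (hpc.mono_left hle) (hqc.mono_left hle) ?_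
    rw [(nhdsLT_basis x).frequently_iff]
    intro b hb
    obtain ⟨y, hy, he⟩ := h (max b 0) x (le_max_right _ _) (max_lt hb hx0) hx.2
    exact ⟨y, ⟨(le_max_left _ _).trans_lt hy.1, hy.2⟩, he⟩

theorem IsPiecewiseContinuous.finite_ne {p q : ℝ → ℝ} (hp : IsPiecewiseContinuous p)
    (hq : IsPiecewiseContinuous q) {c : ℝ}
    (h : ∀ x ∈ Icc (0 : ℝ) 1, ContinuousFromCommonSide p q x → p x = c * q x) :
    {x ∈ Icc (0 : ℝ) 1 | p x ≠ c * q x}.Finite := by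
  -- The end points join the exceptional set because the values there are unrestricted.
  refine ((hp.finite_discontinuities.union hq.finite_discontinuities).union
    (Set.toFinite {(0 : ℝ), 1})).subset ?_
  rintro x ⟨hx, hne⟩
  by_contra hcon
  simp only [mem_union, mem_ofPred_eq, mem_insert_iff, mem_singleton_iff, not_or] at hcon
  obtain ⟨⟨h1, h2⟩, h3, h4⟩ := hcon
  have hxI : x ∈ Ioo (0 : ℝ) 1 := ⟨lt_of_le_of_ne hx.1 (Ne.symm h3), lt_of_le_of_ne hx.2 h4⟩
  exact hne (h x hx (Or.inl ⟨hxI.2,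
    (by_contra fun hc => h1 ⟨hxI, hc⟩ : ContinuousAt p x).continuousWithinAt,
    (by_contra fun hc => h2 ⟨hxI, hc⟩ : ContinuousAt q x).continuousWithinAt⟩))

theorem theorem2p3 (p pt : ℝ → ℝ) (hp : IsStringDensity p) (hpt : IsStringDensity pt)
    (α β : ℝ) (hα : α ∈ Set.Ioc 0 Real.pi) (hβ : β ∈ Set.Ico 0 Real.pi)
    (n : ℕ) (hn : 0 < n) (lam lamt : ℝ)
    (hlam : IsNthStringEigenvalue p α β n lam)
    (hlamt : IsNthStringEigenvalue pt α β n lamt)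
    (hlam0 : lam ≠ 0)
    (phit : ℝ → ℂ) (hphit : IsStringPhi pt α (lamt : ℂ) phit)
    (hquot : (lam : ℂ) = (lamt : ℂ) *
      (stringInner (fun x => ((pt x / p x : ℝ) : ℂ) * phit x) phit / stringInner phit phit))
    (hext : lam = lamt * sSup ((fun x => pt x / p x) '' Set.Icc (0 : ℝ) 1) ∨
      lam = lamt * sInf ((fun x => pt x / p x) '' Set.Icc (0 : ℝ) 1)) :
    {x ∈ Set.Icc (0 : ℝ) 1 | p x ≠ lamt / lam * pt x}.Finite ∧
      ∀ x ∈ Set.Icc (0 : ℝ) 1, ContinuousFromCommonSide p pt x →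
        p x = lamt / lam * pt x := by
  obtain ⟨C, hC⟩ := hp.div_mem_Icc hpt
  have hcont : ContinuousOn phit (Icc 0 1) := hphit.solution.contDiffOn.continuousOn
  obtain ⟨S, hlS, hS⟩ : ∃ S, lam = lamt * S ∧
      ((∀ x ∈ Icc (0 : ℝ) 1, pt x / p x ≤ S) ∨ ∀ x ∈ Icc (0 : ℝ) 1, S ≤ pt x / p x) := by
    rcases hext with h | h
    · refine ⟨_, h, Or.inl fun x hx => le_csSup ⟨C, ?_⟩ (mem_image_of_mem _ hx)⟩
      rintro _ ⟨y, hy, rfl⟩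
      exact (hC y hy).2
    · refine ⟨_, h, Or.inr fun x hx => csInf_le ⟨0, ?_⟩ (mem_image_of_mem _ hx)⟩
      rintro _ ⟨y, hy, rfl⟩
      exact (hC y hy).1
  have hlamt0 : lamt ≠ 0 := by
    rintro rfl
    exact hlam0 (by simpa using hlS)
  have hint : IntervalIntegrable (fun x => pt x / p x * ‖phit x‖ ^ 2) volume 0 1 := by
    have hN : IntervalIntegrable (fun x => ‖phit x‖ ^ 2) volume 0 1 := by
      refine ContinuousOn.intervalIntegrable ?_
      rw [uIcc_of_le zero_le_one]
      fun_prop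
    rw [intervalIntegrable_iff_integrableOn_Ioc_of_le zero_le_one] at hN ⊢
    refine Integrable.bdd_mul (c := C) hN (hpt.piecewiseContinuous.aestronglyMeasurable.div₀
      hp.piecewiseContinuous.aestronglyMeasurable) ?_
    filter_upwards [ae_restrict_mem measurableSet_Ioc] with x hx
    have := hC x (Ioc_subset_Icc_self hx)
    rw [Real.norm_of_nonneg this.1]
    exact this.2
  have hmean : ∫ x in (0 : ℝ)..1, pt x / p x * ‖phit x‖ ^ 2 =
      S * ∫ x in (0 : ℝ)..1, ‖phit x‖ ^ 2 := by
    rw [stringInner_ofReal_mul_self (fun x => pt x / p x), stringInner_self] at hquot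
    norm_cast at hquot
    -- With a zero denominator the quotient would be `0` by convention, forcing `lam = 0`.
    have hN0 : ∫ x in (0 : ℝ)..1, ‖phit x‖ ^ 2 ≠ 0 := fun h => hlam0 (by simpa [h] using hquot)
    have := mul_left_cancel₀ hlamt0 (hlS.symm.trans hquot)
    rw [this, div_mul_cancel₀ _ hN0]
  obtain ⟨c, hc, hcp⟩ := hp.bounded_away
  have hside : ∀ x ∈ Icc (0 : ℝ) 1, ContinuousFromCommonSide p pt x →
      p x = lamt / lam * pt x := by
    intro x hx hx'
    refine eq_of_continuousFromCommonSide (q := fun x => lamt / lam * pt x) ?_ hx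
      (hx'.imp (fun h => ⟨h.1, h.2.1, h.2.2.const_mul _⟩)
        fun h => ⟨h.1, h.2.1, h.2.2.const_mul _⟩)
    intro a b ha hab hb
    obtain ⟨y, hy, he⟩ := exists_eq_of_weightedMean_extreme hcont hint hS hmean ha hb
      (hphit.solution.exists_ne_zero_mem_Ioo hpt.piecewiseContinuous hphit.cauchyData_zero_ne_zero
        ha hab hb)
    refine ⟨y, hy, ?_⟩
    have hpy : p y ≠ 0 :=
      (hc.trans_le (hcp y ⟨ha.trans hy.1.le, hy.2.le.trans hb⟩)).ne'
    rw [div_mul_eq_mul_div, eq_div_iff hlam0, hlS, (div_eq_iff hpy).1 he]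
    ring
  exact ⟨hp.piecewiseContinuous.finite_ne hpt.piecewiseContinuous hside, hside⟩
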